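/- A \emph{stable allocation} of $\mathbb R$ to a discrete set $\Xi\subset\mathbb R$ of centers, with appetite $\alpha\in(0,\infty)$, is a measurable map $\psi:\mathbb R\to\Xi\cup\{\infty,\Delta\}$ such that $\psi^{-1}(\Delta)$ is Lebesgue-null, every territory $\psi^{-1}(\xi)$, $\xi\in\Xi$, has Lebesgue measure at most $\alpha$, and there are no $x\in\mathbb R$ and $\xi\in\Xi$ with $\psi(x)\notin\{\xi,\Delta\}$ satisfying both of the following: (a) $\psi(x)=\infty$ or $|x-\xi|<|x-\psi(x)|$; (b) $\psi^{-1}(\xi)$ has Lebesgue measure different from $\alpha$, or $|x-\xi|<|x'-\xi|$ for some $x'\in\psi^{-1}(\xi)$. Let $[\Pi]$ be the random set of points of a Poisson process on $\mathbb R$ with intensity $1$, let $0<\alpha<\infty$ with $\alpha\neq1$, and put $q(\alpha)=(\alpha-1-\log\alpha)/\alpha$. Let $c\in\mathbb R$ with $c<q(\alpha)$. \textbf{Proposition (explicit bounds for $d=1$).} (i) Let $\Psi$ be, almost surely, a stable allocation to $[\Pi]$ with appetite $\alpha$, and let $X=|\Psi(0)|$ if $\Psi(0)\in[\Pi]$ and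 $X=\infty$ otherwise. Then $\mathbf E\big(e^{cX};X<\infty\big)<\infty$. (ii) Let $\Psi^*$ be, almost surely, a stable allocation to $[\Pi^*]=[\Pi]\cup\{0\}$ with appetite $\alpha$, and let $R^*=\operatorname{ess\,sup}_{x\in(\Psi^*)^{-1}(0)}|x|\in[0,\infty]$. Then $\mathbf E^*e^{cR^*}<\infty$, where $\mathbf E^*$ is expectation for the process $\Pi^*$. These hold for every choice of the versions of $\Psi$ and $\Psi^*$; if the integrand is not measurable for the chosen version, the expectation is understood as the upper expectation (the infimum of the expectations of measurable majorants). -/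

import Mathlib

open MeasureTheory ProbabilityTheory
open scoped ENNReal NNReal

namespace StableAllocation

/-- The value that an allocation gives to a site of `ℝ`: a center `ξ`, or `∞` (the site is
unclaimed), or the exceptional symbol `Δ`. -/
inductive Target where
  | center (ξ : ℝ) : Target
  | unclaimed : Target
  | exceptional : Target

/-- The territory `ψ⁻¹(ξ)` of the center `ξ`. -/
def territory (ψ : ℝ → Target) (ξ : ℝ) : Set ℝ := {x | ψ x = Target.center ξ}

/-- `ψ` is an allocation of `ℝ` to the set of centers `Ξ` with appetite `α`: a measurable function
`ℝ → Ξ ∪ {∞, Δ}` such that `ψ⁻¹(Δ)` is Lebesgue-null and every territory has volume at most `α`.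
(The sets `Ξ` of interest are countable, so measurability means that all fibres are
measurable.) -/
structure IsAllocation (Ξ : Set ℝ) (α : ℝ≥0∞) (ψ : ℝ → Target) : Prop where
  center_mem : ∀ x ξ, ψ x = Target.center ξ → ξ ∈ Ξ
  measurable_fibre : ∀ t : Target, MeasurableSet {x | ψ x = t}
  volume_exceptional : volume {x | ψ x = Target.exceptional} = 0
  volume_territory_le : ∀ ξ ∈ Ξ, volume (territory ψ ξ) ≤ α

/-- The site `x`, with `ψ x ∉ {ξ, Δ}`, desires the center `ξ`: it is unclaimed, or `ξ` is strictly
closer to it than the center it is allocated to. -/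
def Desires (ψ : ℝ → Target) (x ξ : ℝ) : Prop :=
  ψ x = Target.unclaimed ∨ ∃ η, ψ x = Target.center η ∧ η ≠ ξ ∧ |x - ξ| < |x - η|

/-- The center `ξ` covets the site `x`: it is unsated, or `x` is strictly closer to it than some
site of its territory. -/
def Covets (α : ℝ≥0∞) (ψ : ℝ → Target) (ξ x : ℝ) : Prop :=
  volume (territory ψ ξ) ≠ α ∨ ∃ x' ∈ territory ψ ξ, |x - ξ| < |x' - ξ|

/-- `ψ` is a stable allocation to `Ξ` with appetite `α`: an allocation without unstable pairs. -/
structure IsStableAllocation (Ξ : Set ℝ) (α : ℝ≥0∞) (ψ : ℝ → Target) : Prop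
    extends IsAllocation Ξ α ψ where
  no_unstable_pair : ∀ x, ∀ ξ ∈ Ξ, ¬ (Desires ψ x ξ ∧ Covets α ψ ξ x)

/-- The distance `|x - ψ(x)|` from a claimed site to its center. It is `∞` if `x` is unclaimed; the
value at `ψ(x) = Δ` is set to `∞` too, so that `siteDist ψ x < ∞` holds exactly when `x` is
claimed. -/
noncomputable def siteDist (ψ : ℝ → Target) (x : ℝ) : ℝ≥0∞ :=
  match ψ x with
  | Target.center ξ => ENNReal.ofReal |x - ξ|
  | Target.unclaimed => ⊤
  | Target.exceptional => ⊤

/-- The radius `R(ξ) = ess sup_{x ∈ ψ⁻¹(ξ)} |ξ - x|` of the territory of `ξ`. -/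
noncomputable def radius (ψ : ℝ → Target) (ξ : ℝ) : ℝ≥0∞ :=
  essSup (fun x => ENNReal.ofReal |ξ - x|) (volume.restrict (territory ψ ξ))

/-- The random set `S` is (the support of) a homogeneous Poisson process on `ℝ` of intensity `lam`:
it is a.s. locally finite, the number of its points in a Borel set is a random variable, the number
of points in a Borel set of finite volume `v` has the Poisson law of mean `lam * v`, and the numbers
of points in finitely many pairwise disjoint Borel sets are independent. -/
structure IsPoissonProcess {Ω : Type*} [MeasurableSpace Ω] (lam : ℝ≥0) (S : Ω → Set ℝ)
    (P : Measure Ω) : Prop where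
  locally_finite : ∀ᵐ ω ∂P, ∀ K : Set ℝ, IsCompact K → (S ω ∩ K).Finite
  measurable_count : ∀ A : Set ℝ, MeasurableSet A → Measurable fun ω => (S ω ∩ A).encard
  law_count : ∀ A : Set ℝ, MeasurableSet A → volume A < ⊤ →
    P.map (fun ω => (S ω ∩ A).encard) =
      (poissonMeasure (lam * (volume A).toNNReal)).map (fun n : ℕ => (n : ℕ∞))
  indep_count : ∀ (n : ℕ) (A : Fin n → Set ℝ), (∀ i, MeasurableSet (A i)) →
    Pairwise (fun i j => Disjoint (A i) (A j)) →
    iIndepFun (fun i ω => (S ω ∩ A i).encard) P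

/-- The (upper) expectation of a `[0, ∞]`-valued function: the infimum of the expectations of its
measurable majorants. On measurable functions it is the usual expectation. -/
noncomputable def upperExpectation {Ω : Type*} [MeasurableSpace Ω] (P : Measure Ω)
    (f : Ω → ℝ≥0∞) : ℝ≥0∞ :=
  ⨅ (g : Ω → ℝ≥0∞) (_ : Measurable g) (_ : ∀ᵐ ω ∂P, f ω ≤ g ω), ∫⁻ ω, g ω ∂P

/-- On (a.e.-)measurable functions the upper expectation is the usual expectation. -/
theorem upperExpectation_eq_lintegral {Ω : Type*} [MeasurableSpace Ω] (P : Measure Ω)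
    (f : Ω → ℝ≥0∞) (hf : AEMeasurable f P) : upperExpectation P f = ∫⁻ ω, f ω ∂P := by
  apply le_antisymm
  · rw [lintegral_congr_ae hf.ae_eq_mk]
    exact iInf₂_le_of_le hf.mk hf.measurable_mk (iInf_le _ hf.ae_eq_mk.le)
  · exact le_iInf fun g => le_iInf fun _ => le_iInf fun hfg => lintegral_mono_ae hfg

/-- The function `q(x) = (x - 1 - log x) / x`, used for `x > 0`. -/
noncomputable def q (x : ℝ) : ℝ := (x - 1 - Real.log x) / x

/-- The exponential `e^{c R}` in `[0, ∞]` of a real multiple of an extended nonnegative `R`; for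
`R = ∞` it is `∞`, `1` or `0` according to the sign of `c`. -/
noncomputable def expMul (c : ℝ) (R : ℝ≥0∞) : ℝ≥0∞ := EReal.exp ((c : EReal) * (R : EReal))

end StableAllocation

/-! If `x` is allocated to `ξ`, stability makes the interval between them nearly self-contained:
almost all its sites belong to centers in it, and the centers strictly inside are sated by territory
in it. Comparing lengths, it holds |x - ξ| / α centers up to a bounded error
(`IsStableAllocation.count_bounds`).

The Poisson mean is |x - ξ| and α ≠ 1, so this is a large deviation. With s = 1/α, E s^N =
e^{t(s-1)} for a set of length t, and Chernoff's bound decays at rate 1 - s + s log s = q(α).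
Summing over integer lengths and both sides of the origin gives one integrable `g` dominating
e^{c|z|} for every z that meets the count bounds (`IsPoissonProcess.exists_majorant`). Since `g`
depends only on the process, it serves the site 0 in (i) and the center 0 in (ii), for any version
of the allocation. -/

namespace StableAllocation

/-! ### Deterministic geometry of stable allocations on the line. -/

variable {Ξ : Set ℝ} {α : ℝ≥0∞} {ψ : ℝ → Target} {x ξ : ℝ}

/-- Every site strictly between a site `x` and its center `ξ` is exceptional or claimed by a center
between `x` and `ξ`. -/
theorem IsStableAllocation.center_mem_uIcc (h : IsStableAllocation Ξ α ψ) (hξ : ξ ∈ Ξ)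
    (hx : ψ x = .center ξ) {y : ℝ} (hy : y ∈ Set.uIoo x ξ) :
    ψ y = .exceptional ∨ ∃ η ∈ Ξ ∩ Set.uIcc x ξ, ψ y = .center η := by
  have hcov : Covets α ψ ξ y := Or.inr ⟨x, hx, by
    rcases le_total x ξ with hle | hle
    · rw [Set.uIoo_of_le hle] at hy
      rw [abs_of_neg (by linarith [hy.2]), abs_of_nonpos (by linarith)]; linarith [hy.1]
    · rw [Set.uIoo_of_ge hle] at hy
      rw [abs_of_pos (by linarith [hy.1]), abs_of_nonneg (by linarith)]; linarith [hy.2]⟩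
  have hnd : ¬ Desires ψ y ξ := fun hd => h.no_unstable_pair y ξ hξ ⟨hd, hcov⟩
  match hψ : ψ y with
  | .exceptional => exact Or.inl rfl
  | .unclaimed => exact absurd (Or.inl hψ) hnd
  | .center η =>
    have hη : η ∈ Ξ := h.center_mem y η hψ
    refine Or.inr ⟨η, ⟨hη, ?_⟩, rfl⟩
    by_cases hηξ : η = ξ
    · rw [hηξ]; exact Set.right_mem_uIcc
    have hle : |y - η| ≤ |y - ξ| := by
      by_contra hlt
      exact hnd (Or.inr ⟨η, hψ, hηξ, not_le.1 hlt⟩)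
    -- Otherwise `η` lies beyond `x`, as beyond `ξ` it would be too far from `y`. Then |x - η| < |y
    -- - η| ≤ |y - ξ| < |x - ξ|, and `x`, `η` are unstable.
    by_contra hmem
    refine h.no_unstable_pair x η hη ⟨Or.inr ⟨ξ, hx, Ne.symm hηξ, ?_⟩, Or.inr ⟨y, hψ, ?_⟩⟩ <;>
    · rcases le_total x ξ with hxξ | hxξ
      · rw [Set.uIoo_of_le hxξ] at hy
        rw [Set.uIcc_of_le hxξ] at hmem
        grind
      · rw [Set.uIoo_of_ge hxξ] at hy
        rw [Set.uIcc_of_ge hxξ] at hmem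
        grind

/-- Every center strictly between a site `x` and its center `ξ` is sated. -/
theorem IsStableAllocation.not_covets_of_mem_uIoo (h : IsStableAllocation Ξ α ψ)
    (hx : ψ x = .center ξ) {η : ℝ} (hη : η ∈ Ξ) (hmem : η ∈ Set.uIoo x ξ) :
    ¬ Covets α ψ η x := by
  refine fun hc => h.no_unstable_pair x η hη ⟨Or.inr ⟨ξ, hx, ?_, ?_⟩, hc⟩ <;>
  · rcases le_total x ξ with hxξ | hxξ
    · rw [Set.uIoo_of_le hxξ] at hmem
      grind
    · rw [Set.uIoo_of_ge hxξ] at hmem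
      grind

/-- The territory of a center strictly between a site `x` and its center `ξ` lies between `x` and
`ξ`. -/
theorem IsStableAllocation.territory_subset_uIcc (h : IsStableAllocation Ξ α ψ) (hξ : ξ ∈ Ξ)
    (hx : ψ x = .center ξ) {η : ℝ} (hη : η ∈ Ξ) (hmem : η ∈ Set.uIoo x ξ) :
    territory ψ η ⊆ Set.uIcc x ξ := by
  intro y hy
  have hle : |y - η| ≤ |x - η| := by
    by_contra hlt
    exact h.not_covets_of_mem_uIoo hx hη hmem (Or.inr ⟨y, hy, not_le.1 hlt⟩)
  -- By `hle`, `y` can only lie beyond `ξ`, so |y - ξ| < |y - η| ≤ |x - η| < |x - ξ|, and `y`, `ξ`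
  -- are unstable.
  by_contra hyn
  refine h.no_unstable_pair y ξ hξ ⟨Or.inr ⟨η, hy, ?_, ?_⟩, Or.inr ⟨x, hx, ?_⟩⟩ <;>
  · rcases le_total x ξ with hxξ | hxξ
    · rw [Set.uIoo_of_le hxξ] at hmem
      rw [Set.uIcc_of_le hxξ] at hyn
      grind
    · rw [Set.uIoo_of_ge hxξ] at hmem
      rw [Set.uIcc_of_ge hxξ] at hyn
      grind

/-- The centers between a site `x` and its center `ξ` have enough appetite for the sites between
`x` and `ξ`. -/
theorem IsStableAllocation.abs_sub_le_ncard {a : ℝ} (ha : 0 < a)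
    (h : IsStableAllocation Ξ (ENNReal.ofReal a) ψ) (hfin : (Ξ ∩ Set.uIcc x ξ).Finite)
    (hξ : ξ ∈ Ξ) (hx : ψ x = .center ξ) :
    |x - ξ| ≤ a * (Ξ ∩ Set.uIcc x ξ).ncard := by
  have hsub : Set.uIoo x ξ ⊆
      {y | ψ y = .exceptional} ∪ ⋃ η ∈ hfin.toFinset, territory ψ η := by
    intro y hy
    rcases h.center_mem_uIcc hξ hx hy with hy | ⟨η, hη, hy⟩
    · exact Or.inl hy
    · exact Or.inr (Set.mem_biUnion (hfin.mem_toFinset.2 hη) hy)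
  have hvol : ENNReal.ofReal |x - ξ| ≤ ENNReal.ofReal (a * (Ξ ∩ Set.uIcc x ξ).ncard) := by
    calc ENNReal.ofReal |x - ξ| = volume (Set.uIoo x ξ) := by
          rw [Set.uIoo, Real.volume_Ioo, max_sub_min_eq_abs', abs_sub_comm]
      _ ≤ _ := measure_mono hsub
      _ ≤ 0 + ∑ η ∈ hfin.toFinset, volume (territory ψ η) :=
          (measure_union_le _ _).trans
            (add_le_add h.volume_exceptional.le (measure_biUnion_finset_le _ _))
      _ ≤ ∑ η ∈ hfin.toFinset, ENNReal.ofReal a := by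
          rw [zero_add]
          exact Finset.sum_le_sum fun η hη =>
            h.volume_territory_le η (hfin.mem_toFinset.1 hη).1
      _ = _ := by
          rw [Finset.sum_const, nsmul_eq_mul, mul_comm, ENNReal.ofReal_mul ha.le,
            ENNReal.ofReal_natCast, Set.ncard_eq_toFinset_card _ hfin]
  exact (ENNReal.ofReal_le_ofReal_iff (by positivity)).1 hvol

/-- The territories of the centers strictly between a site `x` and its center `ξ` fit between `x`
and `ξ`. -/
theorem IsStableAllocation.ncard_le_abs_sub {a : ℝ} (ha : 0 < a)
    (h : IsStableAllocation Ξ (ENNReal.ofReal a) ψ) (hfin : (Ξ ∩ Set.uIoo x ξ).Finite)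
    (hξ : ξ ∈ Ξ) (hx : ψ x = .center ξ) :
    a * (Ξ ∩ Set.uIoo x ξ).ncard ≤ |x - ξ| := by
  have hvol : ENNReal.ofReal (a * (Ξ ∩ Set.uIoo x ξ).ncard) ≤ ENNReal.ofReal |x - ξ| := by
    calc ENNReal.ofReal (a * (Ξ ∩ Set.uIoo x ξ).ncard)
        = ∑ η ∈ hfin.toFinset, ENNReal.ofReal a := by
          rw [Finset.sum_const, nsmul_eq_mul, mul_comm, ENNReal.ofReal_mul' (by positivity),
            ENNReal.ofReal_natCast, Set.ncard_eq_toFinset_card _ hfin]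
      _ = ∑ η ∈ hfin.toFinset, volume (territory ψ η) := by
          refine Finset.sum_congr rfl fun η hη => ?_
          have hη := hfin.mem_toFinset.1 hη
          by_contra hne
          exact h.not_covets_of_mem_uIoo hx hη.1 hη.2 (Or.inl (Ne.symm hne))
      _ = volume (⋃ η ∈ hfin.toFinset, territory ψ η) := by
          refine (measure_biUnion_finset ?_ fun η _ => h.measurable_fibre (.center η)).symm
          intro η _ η' _ hne
          refine Set.disjoint_left.2 fun y hy hy' => hne ?_
          exact Target.center.inj (Eq.trans (Eq.symm hy) hy')
      _ ≤ volume (Set.uIcc x ξ) := by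
          refine measure_mono (Set.iUnion₂_subset fun η hη => ?_)
          have hη := hfin.mem_toFinset.1 hη
          exact h.territory_subset_uIcc hξ hx hη.1 hη.2
      _ = ENNReal.ofReal |x - ξ| := by
          rw [Set.uIcc, Real.volume_Icc, max_sub_min_eq_abs', abs_sub_comm]
  exact (ENNReal.ofReal_le_ofReal_iff (abs_nonneg _)).1 hvol

/-- The count estimates for a stable allocation, when the site or its center is the origin, in terms
of a set `T` that differs from the set of centers at most at the origin. -/
theorem IsStableAllocation.count_bounds {a : ℝ} (ha : 0 < a) {T : Set ℝ} {z : ℝ}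
    (h : IsStableAllocation Ξ (ENNReal.ofReal a) ψ) (hTΞ : T ⊆ Ξ) (hΞT : Ξ ⊆ insert 0 T)
    (hfin : ∀ K : Set ℝ, IsCompact K → (T ∩ K).Finite) (hx : ψ x = .center ξ)
    (hz : x = 0 ∧ ξ = z ∨ x = z ∧ ξ = 0) :
    |z| ≤ a * ((T ∩ Set.uIcc 0 z).ncard + 1) ∧ a * (T ∩ Set.uIoo 0 z).ncard ≤ |z| := by
  have hξ := h.center_mem x ξ hx
  have hIcc : Set.uIcc x ξ = Set.uIcc 0 z := by
    rcases hz with ⟨rfl, rfl⟩ | ⟨rfl, rfl⟩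
    · rfl
    · exact Set.uIcc_comm _ _
  have hIoo : Set.uIoo x ξ = Set.uIoo 0 z := by
    rcases hz with ⟨rfl, rfl⟩ | ⟨rfl, rfl⟩
    · rfl
    · exact Set.uIoo_comm _ _
  have habs : |x - ξ| = |z| := by
    rcases hz with ⟨rfl, rfl⟩ | ⟨rfl, rfl⟩ <;> simp
  have hT : (T ∩ Set.uIcc 0 z).Finite := hfin _ isCompact_uIcc
  have hsub : Ξ ∩ Set.uIcc 0 z ⊆ insert 0 (T ∩ Set.uIcc 0 z) := fun y hy =>
    (hΞT hy.1).imp id fun hyT => ⟨hyT, hy.2⟩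
  have hΞ : (Ξ ∩ Set.uIcc 0 z).Finite := (hT.insert 0).subset hsub
  have hΞ' : (Ξ ∩ Set.uIoo 0 z).Finite :=
    hΞ.subset (Set.inter_subset_inter_right _ Set.uIoo_subset_uIcc_self)
  constructor
  · have h1 := h.abs_sub_le_ncard ha (by rwa [hIcc]) hξ hx
    rw [hIcc, habs] at h1
    -- The extra 1 pays for a center at the origin that is missing from `T`.
    have h2 : (Ξ ∩ Set.uIcc 0 z).ncard ≤ (T ∩ Set.uIcc 0 z).ncard + 1 :=
      (Set.ncard_le_ncard hsub (hT.insert 0)).trans (Set.ncard_insert_le _ _)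
    exact h1.trans (mul_le_mul_of_nonneg_left (mod_cast h2) ha.le)
  · have h1 := h.ncard_le_abs_sub ha (by rwa [hIoo]) hξ hx
    rw [hIoo, habs] at h1
    refine le_trans (mul_le_mul_of_nonneg_left ?_ ha.le) h1
    exact_mod_cast Set.ncard_le_ncard (Set.inter_subset_inter_left _ hTΞ) hΞ'

end StableAllocation

/-! ### Chernoff bounds for the Poisson process and the integrable majorant. -/

namespace StableAllocation

/-- The probability generating function of the Poisson distribution. -/
theorem lintegral_pow_poissonMeasure (r : ℝ≥0) {s : ℝ} (hs : 0 ≤ s) :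
    ∫⁻ n, ENNReal.ofReal (s ^ n) ∂(poissonMeasure r) = ENNReal.ofReal (Real.exp (r * (s - 1))) := by
  have hsum : HasSum (fun n : ℕ => Real.exp (-r) * r ^ n / n.factorial * s ^ n)
      (Real.exp (r * (s - 1))) := by
    convert! (NormedSpace.expSeries_div_hasSum_exp (r * s : ℝ)).mul_left (Real.exp (-r)) using 1
    · funext n
      rw [mul_pow]
      ring
    · rw [← Real.exp_eq_exp_ℝ, ← Real.exp_add]
      ring_nf
  rw [poissonMeasure, lintegral_sum_measure]
  simp only [lintegral_smul_measure, lintegral_dirac, smul_eq_mul]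
  rw [← hsum.tsum_eq, ENNReal.ofReal_tsum_of_nonneg (fun n => by positivity) hsum.summable]
  refine tsum_congr fun n => (ENNReal.ofReal_mul (by positivity)).symm

variable {Ω : Type*} [MeasurableSpace Ω] {P : Measure Ω} {S : Ω → Set ℝ}

theorem IsPoissonProcess.measurable_pow_ncard {lam : ℝ≥0} (hS : IsPoissonProcess lam S P)
    {A : Set ℝ} (hA : MeasurableSet A) (s : ℝ) :
    Measurable fun ω => ENNReal.ofReal (s ^ (S ω ∩ A).ncard) :=
  (measurable_of_countable fun k : ℕ∞ => ENNReal.ofReal (s ^ k.toNat)).comp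
    (hS.measurable_count A hA)

/-- The probability generating function of the number of points of a Poisson process in a set. -/
theorem IsPoissonProcess.lintegral_pow_ncard {lam : ℝ≥0} (hS : IsPoissonProcess lam S P)
    {A : Set ℝ} (hA : MeasurableSet A) (hvol : volume A < ⊤) {s : ℝ} (hs : 0 ≤ s) :
    ∫⁻ ω, ENNReal.ofReal (s ^ (S ω ∩ A).ncard) ∂P =
      ENNReal.ofReal (Real.exp (lam * (volume A).toReal * (s - 1))) := by
  have hf : Measurable fun k : ℕ∞ => ENNReal.ofReal (s ^ k.toNat) := measurable_of_countable _
  calc ∫⁻ ω, ENNReal.ofReal (s ^ (S ω ∩ A).ncard) ∂P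
      = ∫⁻ k, ENNReal.ofReal (s ^ k.toNat) ∂(P.map fun ω => (S ω ∩ A).encard) :=
        (lintegral_map hf (hS.measurable_count A hA)).symm
    _ = ∫⁻ n, ENNReal.ofReal (s ^ n) ∂(poissonMeasure (lam * (volume A).toNNReal)) := by
        rw [hS.law_count A hA hvol, lintegral_map hf (measurable_of_countable _)]
        rfl
    _ = _ := by
        rw [lintegral_pow_poissonMeasure _ hs]
        rfl

theorem q_pos {a : ℝ} (ha : 0 < a) (ha1 : a ≠ 1) : 0 < q a :=
  div_pos (by linarith [Real.log_lt_sub_one_of_pos ha ha1]) ha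

/-- This is the Chernoff rate 1 - s + s log s at the optimal s = 1/a. -/
theorem q_eq {a : ℝ} (ha : 0 < a) : q a = 1 - a⁻¹ + a⁻¹ * Real.log a⁻¹ := by
  rw [q, Real.log_inv]
  field_simp
  ring

/-- If the sets `A n` have volumes `n + b` and the weights `exp (u * n + v)` compensate
`s ^ |S ∩ A n|`, then the exponential of rate `c` along the weighted sum is integrable. -/
theorem IsPoissonProcess.lintegral_tsum_lt_top (hS : IsPoissonProcess 1 S P)
    {A : ℕ → Set ℝ} (hA : ∀ n, MeasurableSet (A n)) {b : ℝ} (hb : 0 ≤ b)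
    (hvol : ∀ n, volume (A n) = ENNReal.ofReal (n + b)) {s u v c : ℝ} (hs : 0 ≤ s)
    (hc : c + u + (s - 1) < 0) :
    ∫⁻ ω, ∑' n : ℕ, ENNReal.ofReal (Real.exp (c * (n + 1) + (u * n + v))) *
      ENNReal.ofReal (s ^ (S ω ∩ A n).ncard) ∂P < ⊤ := by
  rw [lintegral_tsum fun n => ((hS.measurable_pow_ncard (hA n) s).const_mul _).aemeasurable]
  have hterm : ∀ n : ℕ, ∫⁻ ω, ENNReal.ofReal (Real.exp (c * (n + 1) + (u * n + v))) *
      ENNReal.ofReal (s ^ (S ω ∩ A n).ncard) ∂P =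
      ENNReal.ofReal (Real.exp (c + v + b * (s - 1)) * Real.exp (c + u + (s - 1)) ^ n) := by
    intro n
    rw [lintegral_const_mul _ (hS.measurable_pow_ncard (hA n) s),
      hS.lintegral_pow_ncard (hA n) (by rw [hvol]; exact ENNReal.ofReal_lt_top) hs, hvol,
      ENNReal.toReal_ofReal (by positivity), ← ENNReal.ofReal_mul (Real.exp_nonneg _),
      ← Real.exp_add, ← Real.exp_nat_mul, ← Real.exp_add]
    congr 2
    push_cast
    ring
  simp_rw [hterm]
  rw [← ENNReal.ofReal_tsum_of_nonneg (fun n => by positivity)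
    ((summable_geometric_of_lt_one (Real.exp_nonneg _) (Real.exp_lt_one_iff.2 hc)).mul_left _)]
  exact ENNReal.ofReal_lt_top

/-- An integrable majorant of `exp (c * t)` over all `t ≥ 0`
such that the number of points in `A ⌊t⌋` compensates the weight. -/
theorem IsPoissonProcess.exists_majorant_of_sets (hS : IsPoissonProcess 1 S P)
    {A : ℕ → Set ℝ} (hA : ∀ n, MeasurableSet (A n)) {b : ℝ} (hb : 0 ≤ b)
    (hvol : ∀ n, volume (A n) = ENNReal.ofReal (n + b)) {s u v c : ℝ} (hs : 0 < s) (hc0 : 0 ≤ c)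
    (hc : c + u + (s - 1) < 0) :
    ∃ g : Ω → ℝ≥0∞, Measurable g ∧ ∫⁻ ω, g ω ∂P < ⊤ ∧ ∀ ω t, 0 ≤ t →
      0 ≤ u * ⌊t⌋₊ + v + (S ω ∩ A ⌊t⌋₊).ncard * Real.log s →
      ENNReal.ofReal (Real.exp (c * t)) ≤ g ω := by
  refine ⟨_, Measurable.tsum fun n => (hS.measurable_pow_ncard (hA n) s).const_mul _,
    hS.lintegral_tsum_lt_top hA hb hvol hs.le (v := v) hc, fun ω t ht h0 => ?_⟩
  -- The single term n = ⌊t⌋ suffices; the n + 1 in its exponent absorbs the rounding of t.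
  refine le_trans ?_ (ENNReal.le_tsum ⌊t⌋₊)
  rw [← ENNReal.ofReal_mul (Real.exp_nonneg _), ← Real.exp_log (pow_pos hs _), ← Real.exp_add,
    Real.log_pow]
  refine ENNReal.ofReal_le_ofReal (Real.exp_le_exp.2 ?_)
  have := mul_le_mul_of_nonneg_left (Nat.lt_floor_add_one t).le hc0
  linarith

/-- An integrable majorant of `exp (c * |z|)` over all `z` such that the number of points between
`0` and `z` is close to `|z| / a`. -/
theorem IsPoissonProcess.exists_majorant (hS : IsPoissonProcess 1 S P) {a c : ℝ} (ha : 0 < a)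
    (ha1 : a ≠ 1) (hc0 : 0 ≤ c) (hc : c < q a) :
    ∃ g : Ω → ℝ≥0∞, Measurable g ∧ ∫⁻ ω, g ω ∂P < ⊤ ∧ ∀ᵐ ω ∂P, ∀ z : ℝ,
      |z| ≤ a * ((S ω ∩ Set.uIcc 0 z).ncard + 1) → a * (S ω ∩ Set.uIoo 0 z).ncard ≤ |z| →
      ENNReal.ofReal (Real.exp (c * |z|)) ≤ g ω := by
  have hs : 0 < a⁻¹ := inv_pos.2 ha
  rw [q_eq ha] at hc
  have hmul : ∀ {x y : ℝ}, x ≤ a * y → a⁻¹ * x ≤ y := fun h => by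
    rwa [inv_mul_le_iff₀ ha]
  have hmul' : ∀ {x y : ℝ}, a * y ≤ x → y ≤ a⁻¹ * x := fun h => by
    rwa [le_inv_mul_iff₀ ha]
  rcases lt_or_gt_of_ne ha1 with hlt | hgt
  -- Upper tail: too many points, so the sets are enlarged to length n + 1. The weights encode n/a ≤
  -- N + 1, multiplied by log s ≥ 0.
  · have hlog : 0 ≤ Real.log a⁻¹ := Real.log_nonneg (one_le_inv₀ ha |>.2 hlt.le)
    obtain ⟨g₁, hg₁, hi₁, h₁⟩ := hS.exists_majorant_of_sets (A := fun n => Set.Icc 0 (n + 1))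
      (fun n => measurableSet_Icc) zero_le_one (fun n => by simp)
      (s := a⁻¹) (u := -(a⁻¹ * Real.log a⁻¹)) (v := Real.log a⁻¹) hs hc0 (by linarith)
    obtain ⟨g₂, hg₂, hi₂, h₂⟩ := hS.exists_majorant_of_sets (A := fun n => Set.Icc (-(n + 1)) 0)
      (fun n => measurableSet_Icc) zero_le_one (fun n => by simp)
      (s := a⁻¹) (u := -(a⁻¹ * Real.log a⁻¹)) (v := Real.log a⁻¹) hs hc0 (by linarith)
    refine ⟨fun ω => g₁ ω + g₂ ω, hg₁.add hg₂, ?_, ?_⟩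
    · rw [lintegral_add_left hg₁]
      exact ENNReal.add_lt_top.2 ⟨hi₁, hi₂⟩
    filter_upwards [hS.locally_finite] with ω hω z hz _
    have key : ∀ A : Set ℝ, IsCompact A → Set.uIcc 0 z ⊆ A →
        0 ≤ -(a⁻¹ * Real.log a⁻¹) * ⌊|z|⌋₊ + Real.log a⁻¹ + (S ω ∩ A).ncard * Real.log a⁻¹ := by
      intro A hA hsub
      have h1 : ((S ω ∩ Set.uIcc 0 z).ncard : ℝ) ≤ (S ω ∩ A).ncard :=
        mod_cast Set.ncard_le_ncard (Set.inter_subset_inter_right _ hsub) (hω A hA)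
      have h2 := mul_le_mul_of_nonneg_left (Nat.floor_le (abs_nonneg z)) hs.le
      have h3 := hmul hz
      have h4 : a⁻¹ * ⌊|z|⌋₊ ≤ (S ω ∩ A).ncard + 1 := by linarith
      linarith [mul_le_mul_of_nonneg_right h4 hlog]
    have hfl := Nat.lt_floor_add_one |z|
    rcases le_total 0 z with h0 | h0
    · refine (h₁ ω |z| (abs_nonneg z) (key _ isCompact_Icc ?_)).trans le_self_add
      rw [Set.uIcc_of_le h0]
      exact Set.Icc_subset_Icc le_rfl (by linarith [le_abs_self z])
    · refine (h₂ ω |z| (abs_nonneg z) (key _ isCompact_Icc ?_)).trans le_add_self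
      rw [Set.uIcc_of_ge h0]
      exact Set.Icc_subset_Icc (by linarith [neg_abs_le z]) le_rfl
  -- Lower tail: too few points, so the sets are shrunk to length n. The weights encode N ≤ (n +
  -- 1)/a, multiplied by log s ≤ 0.
  · have hlog : Real.log a⁻¹ ≤ 0 := Real.log_nonpos hs.le (inv_le_one_of_one_le₀ hgt.le)
    obtain ⟨g₁, hg₁, hi₁, h₁⟩ := hS.exists_majorant_of_sets (A := fun n => Set.Ioo 0 (n : ℝ))
      (fun n => measurableSet_Ioo) le_rfl (fun n => by simp)
      (s := a⁻¹) (u := -(a⁻¹ * Real.log a⁻¹)) (v := -(a⁻¹ * Real.log a⁻¹)) hs hc0 (by linarith)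
    obtain ⟨g₂, hg₂, hi₂, h₂⟩ := hS.exists_majorant_of_sets (A := fun n => Set.Ioo (-(n : ℝ)) 0)
      (fun n => measurableSet_Ioo) le_rfl (fun n => by simp)
      (s := a⁻¹) (u := -(a⁻¹ * Real.log a⁻¹)) (v := -(a⁻¹ * Real.log a⁻¹)) hs hc0 (by linarith)
    refine ⟨fun ω => g₁ ω + g₂ ω, hg₁.add hg₂, ?_, ?_⟩
    · rw [lintegral_add_left hg₁]
      exact ENNReal.add_lt_top.2 ⟨hi₁, hi₂⟩
    filter_upwards [hS.locally_finite] with ω hω z _ hz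
    have key : ∀ A : Set ℝ, A ⊆ Set.uIoo 0 z →
        0 ≤ -(a⁻¹ * Real.log a⁻¹) * ⌊|z|⌋₊ + -(a⁻¹ * Real.log a⁻¹) +
          (S ω ∩ A).ncard * Real.log a⁻¹ := by
      intro A hsub
      have hfin : (S ω ∩ Set.uIoo 0 z).Finite := (hω _ isCompact_uIcc).subset
        (Set.inter_subset_inter_right _ Set.uIoo_subset_uIcc_self)
      have h1 : ((S ω ∩ A).ncard : ℝ) ≤ (S ω ∩ Set.uIoo 0 z).ncard :=
        mod_cast Set.ncard_le_ncard (Set.inter_subset_inter_right _ hsub) hfin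
      have h2 := mul_le_mul_of_nonneg_left (Nat.lt_floor_add_one |z|).le hs.le
      have h3 := hmul' hz
      have h4 : ((S ω ∩ A).ncard : ℝ) ≤ a⁻¹ * (⌊|z|⌋₊ + 1) := by linarith
      linarith [mul_le_mul_of_nonpos_right h4 hlog]
    have hfl := Nat.floor_le (abs_nonneg z)
    rcases le_total 0 z with h0 | h0
    · refine (h₁ ω |z| (abs_nonneg z) (key _ ?_)).trans le_self_add
      rw [Set.uIoo_of_le h0]
      exact Set.Ioo_subset_Ioo le_rfl (by rwa [abs_of_nonneg h0] at hfl ⊢)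
    · refine (h₂ ω |z| (abs_nonneg z) (key _ ?_)).trans le_add_self
      rw [Set.uIoo_of_ge h0]
      exact Set.Ioo_subset_Ioo (by rw [abs_of_nonpos h0] at hfl ⊢; linarith) le_rfl

end StableAllocation

/-! ### From the majorant to the two expectations. -/

namespace StableAllocation

theorem upperExpectation_lt_top {Ω : Type*} [MeasurableSpace Ω] {P : Measure Ω} {f g : Ω → ℝ≥0∞}
    (hg : Measurable g) (hfg : ∀ᵐ ω ∂P, f ω ≤ g ω) (hi : ∫⁻ ω, g ω ∂P < ⊤) :
    upperExpectation P f < ⊤ :=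
  (iInf₂_le_of_le g hg (iInf_le _ hfg)).trans_lt hi

theorem expMul_mono_left {c c' : ℝ} (hc : c ≤ c') (R : ℝ≥0∞) : expMul c R ≤ expMul c' R :=
  EReal.exp_monotone
    (mul_le_mul_of_nonneg_right (EReal.coe_le_coe_iff.2 hc) (EReal.coe_ennreal_nonneg R))

theorem expMul_mono_right {c : ℝ} (hc : 0 ≤ c) {R R' : ℝ≥0∞} (hR : R ≤ R') :
    expMul c R ≤ expMul c R' :=
  EReal.exp_monotone
    (mul_le_mul_of_nonneg_left (EReal.coe_ennreal_le_coe_ennreal_iff.2 hR) (EReal.coe_nonneg.2 hc))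

theorem expMul_ofReal (c : ℝ) {t : ℝ} (ht : 0 ≤ t) :
    expMul c (ENNReal.ofReal t) = ENNReal.ofReal (Real.exp (c * t)) := by
  rw [expMul, EReal.coe_ennreal_ofReal, max_eq_left ht, ← EReal.coe_mul, EReal.exp_coe]

/-- A bound on `e^{c|x - ξ|}` over the territory of `ξ` bounds `e^{cR(ξ)}`. -/
theorem expMul_radius_le {ψ : ℝ → Target} {ξ c : ℝ} (hc : 0 < c)
    (hm : MeasurableSet (territory ψ ξ)) {B : ℝ≥0∞} (hB1 : 1 ≤ B)
    (hB : ∀ x ∈ territory ψ ξ, ENNReal.ofReal (Real.exp (c * |ξ - x|)) ≤ B) :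
    expMul c (radius ψ ξ) ≤ B := by
  rcases eq_or_ne B ⊤ with rfl | htop
  · exact le_top
  have h1 : 1 ≤ B.toReal := by
    simpa using ENNReal.toReal_mono htop hB1
  have hlog : 0 ≤ Real.log B.toReal / c := div_nonneg (Real.log_nonneg h1) hc.le
  have hR : radius ψ ξ ≤ ENNReal.ofReal (Real.log B.toReal / c) := by
    refine essSup_le_of_ae_le _ ((ae_restrict_iff' hm).2 (ae_of_all _ fun x hx => ?_))
    refine ENNReal.ofReal_le_ofReal ?_
    rw [le_div_iff₀ hc, mul_comm, Real.le_log_iff_exp_le (by linarith)]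
    exact (ENNReal.ofReal_le_iff_le_toReal htop).1 (hB x hx)
  refine (expMul_mono_right hc.le hR).trans ?_
  rw [expMul_ofReal c hlog, mul_div_cancel₀ _ hc.ne', Real.exp_log (by linarith),
    ENNReal.ofReal_toReal htop]

end StableAllocation

theorem mainTheorem8 {Ω : Type*} [MeasurableSpace Ω] (P : Measure Ω) [IsProbabilityMeasure P]
    (S : Ω → Set ℝ) (hS : StableAllocation.IsPoissonProcess 1 S P)
    (α : ℝ) (hα : 0 < α) (hα1 : α ≠ 1) (c : ℝ) (hc : c < StableAllocation.q α) :
    (∀ Ψ : Ω → ℝ → StableAllocation.Target,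
      (∀ᵐ ω ∂P, StableAllocation.IsStableAllocation (S ω) (ENNReal.ofReal α) (Ψ ω)) →
      StableAllocation.upperExpectation P
        (Set.indicator {ω | StableAllocation.siteDist (Ψ ω) 0 < ⊤}
          (fun ω => StableAllocation.expMul c (StableAllocation.siteDist (Ψ ω) 0))) < ⊤) ∧
    (∀ Ψstar : Ω → ℝ → StableAllocation.Target,
      (∀ᵐ ω ∂P, StableAllocation.IsStableAllocation (insert 0 (S ω)) (ENNReal.ofReal α)
        (Ψstar ω)) →
      StableAllocation.upperExpectation P
        (fun ω => StableAllocation.expMul c (StableAllocation.radius (Ψstar ω) 0)) < ⊤) := by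
  open StableAllocation in
  have hq := q_pos hα hα1
  -- As q(α) > 0, the rate may be raised to a positive one.
  obtain ⟨c', hc'0, hcc', hc'⟩ : ∃ c' : ℝ, 0 < c' ∧ c ≤ c' ∧ c' < q α :=
    ⟨max c (q α / 2), lt_max_of_lt_right (half_pos hq), le_max_left _ _,
      max_lt hc (half_lt_self hq)⟩
  obtain ⟨g, hg, hgi, hgb⟩ := hS.exists_majorant hα hα1 hc'0.le hc'
  constructor
  · intro Ψ hΨ
    refine upperExpectation_lt_top hg ?_ hgi
    filter_upwards [hΨ, hgb, hS.locally_finite] with ω hst hb hfin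
    refine Set.indicator_apply_le fun hlt => ?_
    refine (expMul_mono_left hcc' _).trans ?_
    match hψ : Ψ ω 0 with
    | .center ξ =>
      obtain ⟨h1, h2⟩ := hst.count_bounds hα subset_rfl (Set.subset_insert _ _) hfin hψ
        (Or.inl ⟨rfl, rfl⟩)
      have hd : siteDist (Ψ ω) 0 = ENNReal.ofReal |ξ| := by simp [siteDist, hψ]
      rw [hd, expMul_ofReal _ (abs_nonneg ξ)]
      exact hb ξ h1 h2
    | .unclaimed => simp [siteDist, hψ] at hlt
    | .exceptional => simp [siteDist, hψ] at hlt
  · intro Ψ hΨ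
    -- The 1 covers a null territory, where the radius is 0 and `g` need not dominate.
    refine upperExpectation_lt_top (hg.const_add 1) ?_ ?_
    · filter_upwards [hΨ, hgb, hS.locally_finite] with ω hst hb hfin
      refine (expMul_mono_left hcc' _).trans ?_
      refine expMul_radius_le hc'0 (hst.measurable_fibre (.center 0)) le_self_add fun x hx => ?_
      obtain ⟨h1, h2⟩ := hst.count_bounds hα (Set.subset_insert _ _) subset_rfl hfin hx
        (Or.inr ⟨rfl, rfl⟩)
      rw [zero_sub, abs_neg]
      exact (hb x h1 h2).trans le_add_self
    · rw [lintegral_add_left measurable_const, lintegral_const, measure_univ, one_mul]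
      exact ENNReal.add_lt_top.2 ⟨ENNReal.one_lt_top, hgi⟩
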